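/- Let $d\ge 0$ and let $A=(a_1,\dots,a_n)$ be points of $\mathbb{R}^d$ that affinely span $\mathbb{R}^d$ (repeated points and affine dependencies are allowed). Let $v_i=(a_i,1)\in\mathbb{R}^{d+1}$, $V=(v_1,\dots,v_n)$, and let $Z(V)=\sum_{i=1}^n[0,v_i]$ be the zonotope of $V$. For disjoint $I,B\subseteq[n]$ put $\Pi_{I,B}=\sum_{i\in I}v_i+\sum_{b\in B}[0,v_b]$, and put $\Delta_B=\operatorname{conv}\{a_b:b\in B\}$. The faces of $\Pi_{I,B}$ are the $\Pi_{J,C}$ with $C\subseteq B$, $I\subseteq J\subseteq I\sqcup(B\setminus C)$. A *fine zonotopal tiling* $\mathcal P$ of $Z(V)$ is a collection of tiles $\Pi_{I,B}$, labelled by pairs $(I,B)$ of disjoint sets with $|B|=d+1$ and $(a_b)_{b\in B}$ affinely independent, that cover exactly $Z(V)$ and any two of which have empty intersection or intersect in a common (labelled) face. The order of $\Pi_{I,B}$ is $|I|$; write $\mathcal P^{(k)}$ for the set of tiles of order $k$. A *triangulation* of a region $R\subseteq\mathbb{R}^d$ is a collection of simplices $\Delta_B$ (given by their index sets $B$, with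 $|B|=d+1$ and $(a_b)_{b\in B}$ affinely independent) whose union is $R$ and with $\Delta_B\cap\Delta_{B'}=\Delta_{B\cap B'}$ for any two of them. For $Q\subseteq[n]$ and $r\ge 0$ let $E^{(r)}(Q)$ be the union of the $\Delta_B$ over all $\Pi_{I,B}\in\mathcal P^{(r)}$ with $I\subseteq Q$, $B\cap Q=\varnothing$. The *link region* of $Q$ is $\mathcal R(Q)=E^{(|Q|)}(Q)$. **Theorem.** For every fine zonotopal tiling $\mathcal P$ of $Z(V)$ there is a choice of triangulations $\mathcal T_I$ of the link regions $\mathcal R(I)$, one for each $I\subseteq[n]$ such that $\Pi_{I,B}\in\mathcal P$ for some $B$, such that $\mathcal P$ is constructed as follows. 1. $\mathcal I^{(0)}=\{\varnothing\}$. 2. For $0\le k\le n-d-1$ and every $I\in\mathcal I^{(k)}$, the region $\mathcal R(I)$ can be computed from the tiles of order less than $k$ that have already been constructed, as $$\mathcal R(I)=\operatorname{conv}\{a_i:i\notin I\}\setminus\bigcup_{r<k}E^{(r)}(I),$$ where the difference is one of $d$-dimensional regions (the closure of the interior of the set difference); it is triangulated by $\mathcal T_I$, and $$\mathcal P^{(k)}=\{\Pi_{I,B}: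 I\in\mathcal I^{(k)},\ \Delta_B\in\mathcal T_I\}.$$ 3. $\mathcal I^{(k+1)}=\{I\sqcup\{b\}:\Pi_{I,B}\in\mathcal P^{(k)},\ b\in B,\ \mathcal R(I\sqcup\{b\})\ne\varnothing\}$, where $\mathcal R(I\sqcup\{b\})$ is computed from the tiles constructed so far by the formula of step 2. 4. After the step $k=n-d-1$ one has $\mathcal I^{(n-d)}=\varnothing$, the process stops, and $\mathcal P=\bigsqcup_{k=0}^{n-d-1}\mathcal P^{(k)}$. In particular, for every $0\le k\le n-d-1$ the construction gives the spline space of order $k$ associated to $\mathcal P$, i.e. the span of the multivariate (simplex) splines of degree $k$ with knots $(a_i)_{i\in I\sqcup B}$, $\Pi_{I,B}\in\mathcal P^{(k)}$. -/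

import Mathlib

noncomputable section

namespace ZonotopalTiling

/-- Points of `ℝ^d`. -/
abbrev Pt (d : ℕ) : Type := EuclideanSpace ℝ (Fin d)

variable {d n : ℕ}

/-- The projective lift `v_i = (a_i, 1)` of a point, in `ℝ^d × ℝ = ℝ^(d+1)`. -/
def lift (a : Fin n → Pt d) (i : Fin n) : Pt d × ℝ := (a i, 1)

/-- The zonotope `Z(V)`, i.e. the Minkowski sum of the segments `[0, v_i]`. -/
def zonotope (a : Fin n → Pt d) : Set (Pt d × ℝ) :=
  {p | ∃ c : Fin n → ℝ, (∀ i, 0 ≤ c i ∧ c i ≤ 1) ∧ p = ∑ i, c i • lift a i}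

/-- A label `(I, B)`; it stands for the parallelepiped `Π_{I,B}`. -/
abbrev Label (n : ℕ) : Type := Finset (Fin n) × Finset (Fin n)

/-- The parallelepiped `Π_{I,B} = ∑_{i ∈ I} v_i + ∑_{b ∈ B} [0, v_b]`. -/
def cell (a : Fin n → Pt d) (t : Label n) : Set (Pt d × ℝ) :=
  {p | ∃ c : Fin n → ℝ, (∀ b ∈ t.2, 0 ≤ c b ∧ c b ≤ 1) ∧
    p = ∑ i ∈ t.1, lift a i + ∑ b ∈ t.2, c b • lift a b}

/-- `B` indexes `d + 1` affinely independent points. -/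
def IsSimplexIndex (a : Fin n → Pt d) (B : Finset (Fin n)) : Prop :=
  B.card = d + 1 ∧ AffineIndependent ℝ (fun b : B => a b)

/-- `Π_{J,C}` is the face of `Π_{I,B}` obtained by setting the coefficients with index in
`B \ C` equal to `1` (those with index in `J \ I`) or `0` (the others). -/
def IsFace (f t : Label n) : Prop :=
  f.2 ⊆ t.2 ∧ Disjoint f.1 f.2 ∧ t.1 ⊆ f.1 ∧ f.1 ⊆ t.1 ∪ t.2

/-- Fine zonotopal tilings of `Z(V)`: collections of full-dimensional parallelepipeds `Π_{I,B}`
that cover `Z(V)` and any two of which meet in a common face (possibly empty). Tiles and faces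
are labelled by their index sets, which matters when points are repeated or when distinct index
sets have the same sum of vectors. -/
structure IsFineTiling (a : Fin n → Pt d) (P : Set (Label n)) : Prop where
  disjoint : ∀ t ∈ P, Disjoint t.1 t.2
  nondegenerate : ∀ t ∈ P, IsSimplexIndex a t.2
  cover : ⋃ t ∈ P, cell a t = zonotope a
  inter : ∀ t ∈ P, ∀ t' ∈ P, cell a t ∩ cell a t' = ∅ ∨
    ∃ f : Label n, IsFace f t ∧ IsFace f t' ∧ cell a t ∩ cell a t' = cell a f

/-- The tiles of order `k`. -/
def ofOrder (P : Set (Label n)) (k : ℕ) : Set (Label n) := {t ∈ P | t.1.card = k}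

/-- The convex hull `Δ_B` of the points with index in `B`. -/
def simplex (a : Fin n → Pt d) (B : Finset (Fin n)) : Set (Pt d) :=
  convexHull ℝ (a '' (B : Set (Fin n)))

/-- The convex hull `ch_Q(A)` of the points with index outside `Q`. -/
def hullOutside (a : Fin n → Pt d) (Q : Finset (Fin n)) : Set (Pt d) :=
  convexHull ℝ (a '' {i | i ∉ Q})

/-- The region `E^(r)(Q)` determined by the tiles in `S`. -/
def region (a : Fin n → Pt d) (S : Set (Label n)) (r : ℕ) (Q : Finset (Fin n)) : Set (Pt d) :=
  ⋃ t ∈ {t ∈ ofOrder S r | Disjoint t.2 Q ∧ t.1 ⊆ Q}, simplex a t.2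

/-- The link region `R(Q) = E^(k)(Q)`, `k = |Q|`, of a tiling. -/
def linkRegion (a : Fin n → Pt d) (P : Set (Label n)) (Q : Finset (Fin n)) : Set (Pt d) :=
  region a P Q.card Q

/-- The link region of `Q` computed from the tiles of order less than `k = |Q|`: the difference
of `ch_Q(A)` and the union of the `E^(r)(Q)`, `r < k`, as a difference of `d`-dimensional regions,
i.e. as the closure of the interior of the set difference. -/
def computedRegion (a : Fin n → Pt d) (S : Set (Label n)) (Q : Finset (Fin n)) : Set (Pt d) :=
  closure (interior (hullOutside a Q \ ⋃ r ∈ Finset.range Q.card, region a S r Q))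

/-- A triangulation of the region `R` with vertices among the `a_i`: a collection of
nondegenerate simplices `Δ_B`, given by their index sets `B`, that cover `R` exactly and any two
of which meet in their common face. -/
structure IsTriangulation (a : Fin n → Pt d) (T : Set (Finset (Fin n))) (R : Set (Pt d)) :
    Prop where
  nondegenerate : ∀ B ∈ T, IsSimplexIndex a B
  cover : ⋃ B ∈ T, simplex a B = R
  inter : ∀ B ∈ T, ∀ B' ∈ T, simplex a B ∩ simplex a B' = simplex a (B ∩ B')

/-- The tiles `Π_{I,B}` with `I` in a given family of index sets and `Δ_B` in the chosen
triangulation `T I`. -/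
def newTiles (T : Finset (Fin n) → Set (Finset (Fin n))) (J : Set (Finset (Fin n))) :
    Set (Label n) := {t | t.1 ∈ J ∧ t.2 ∈ T t.1}

/-- The state of the construction before stage `k`: the family of index sets `𝓘^(k)` and the
set of all tiles found at the stages before `k`. It depends on the points and on the chosen
triangulations `T` only. -/
def state (a : Fin n → Pt d) (T : Finset (Fin n) → Set (Finset (Fin n))) :
    ℕ → Set (Finset (Fin n)) × Set (Label n)
  | 0 => ({∅}, ∅)
  | k + 1 =>
    let s := state a T k
    let found := s.2 ∪ newTiles T s.1
    ({Q | ∃ t ∈ newTiles T s.1, ∃ b ∈ t.2, Q = insert b t.1 ∧ (computedRegion a found Q).Nonempty},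
      found)

/-- The family of index sets `𝓘^(k)` of the construction. -/
def indexSets (a : Fin n → Pt d) (T : Finset (Fin n) → Set (Finset (Fin n))) (k : ℕ) :
    Set (Finset (Fin n)) := (state a T k).1

/-- All tiles constructed at the stages before `k`. -/
def tilesBefore (a : Fin n → Pt d) (T : Finset (Fin n) → Set (Finset (Fin n))) (k : ℕ) :
    Set (Label n) := (state a T k).2

/-- The tiles constructed at stage `k`: `Π_{I,B}` with `I ∈ 𝓘^(k)` and `Δ_B ∈ T I`. -/
def tilesAt (a : Fin n → Pt d) (T : Finset (Fin n) → Set (Finset (Fin n))) (k : ℕ) :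
    Set (Label n) := newTiles T (indexSets a T k)

/-- The determinant with rows `(a_b, 1)`, `b ∈ B`, in increasing order of `b` (`0` unless
`|B| = d + 1`). -/
def rowDet (a : Fin n → Pt d) (B : Finset (Fin n)) : ℝ :=
  if h : B.card = d + 1 then
    (Matrix.of fun i j : Fin (d + 1) =>
      (Fin.snoc (fun c : Fin d => a (B.orderEmbOfFin h i) c) (1 : ℝ) : Fin (d + 1) → ℝ) j).det
  else 0

/-- `β` selects, from every index set `X` whose points affinely span `ℝ^d`, `d + 1` indices of
affinely independent points. -/
def IsSelection (a : Fin n → Pt d) (β : Finset (Fin n) → Finset (Fin n)) : Prop :=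
  ∀ X, (∃ B ⊆ X, IsSimplexIndex a B) → β X ⊆ X ∧ IsSimplexIndex a (β X)

open Classical in
/-- The normalized multivariate (simplex) spline of degree `k` with knots `a_i`, `i ∈ X`,
`|X| = k + d + 1`, by the usual recurrence, in which the subset `B` of `X` is given by `β`. It is
zero if the knots do not affinely span `ℝ^d`. -/
def spline (a : Fin n → Pt d) (β : Finset (Fin n) → Finset (Fin n)) :
    ℕ → Finset (Fin n) → Pt d → ℝ
  | 0, X, x => if x ∈ simplex a X then (d.factorial : ℝ) / |rowDet a X| else 0
  | k + 1, X, x =>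
    if β X ⊆ X ∧ IsSimplexIndex a (β X) then
      (((k + 1 : ℕ) + d : ℝ) / (k + 1 : ℕ)) * ∑ b ∈ β X,
        rowDet (Function.update a b x) (β X) / rowDet a (β X) * spline a β k (X.erase b) x
    else 0

/-- The space spanned by the splines of degree `k` associated to a collection of tiles of
order `k`. -/
def splineSpace (a : Fin n → Pt d) (β : Finset (Fin n) → Finset (Fin n)) (k : ℕ)
    (S : Set (Label n)) : Submodule ℝ (Pt d → ℝ) :=
  Submodule.span ℝ ((fun t : Label n => spline a β k (t.1 ∪ t.2)) '' S)

end ZonotopalTiling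

end

noncomputable section

namespace ZonotopalTiling

variable {d n : ℕ}

/-! Each tile is the image, under x ↦ ∑ x_i v_i, of a face of the cube [0,1]^n, and a fine tiling
amounts to a section over the zonotope: every point has exactly one preimage in the chosen faces.
The main fact is that deleting a vector v_q, by setting its coefficient to 0, yields a section over
the zonotope of the remaining vectors (`IsSection.del_singleton`). The proof follows the section
along a segment in direction v_q, where the coefficient of v_q grows at rate between 0 and 1
(`IsSection.exists_path`). Iteration deletes any Q.

At height 1/2, no coefficient over a point (ξ,1)/2 of the zonotope with Q deleted can equal 1. The
tiles found there thus have I ⊆ Q, and up to a null set also B ∩ Q = ∅. So the simplices Δ_B with I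
⊆ Q and B ∩ Q = ∅ fill the convex hull of the points outside Q up to a null set, and those with
different I have disjoint interiors. Tiles with I = Q form the link region, those with I ⊊ Q have
lower order, and this is the subtraction formula (`computedRegion_eq`).

It remains to see that no bottom vertex is missed (`exists_lower_tile`). On a generic ray from the
origin through a tile with bottom vertex Q ≠ ∅, the first point in any tile with that bottom vertex
also lies in another tile, whose bottom vertex is Q without one element. Induction on the order
finishes the proof. -/

/-- The linear map `x ↦ ∑ x_i v_i`. -/
def comb (a : Fin n → Pt d) : (Fin n → ℝ) →ₗ[ℝ] Pt d × ℝ := Fintype.linearCombination ℝ (lift a)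

theorem comb_apply (a : Fin n → Pt d) (x : Fin n → ℝ) : comb a x = ∑ i, x i • lift a i :=
  Fintype.linearCombination_apply ..

theorem comb_single (a : Fin n → Pt d) (q : Fin n) (s : ℝ) :
    comb a (Pi.single q s) = s • lift a q := by
  rw [comb_apply, Finset.sum_eq_single q] <;> simp +contextual

theorem continuous_comb (a : Fin n → Pt d) : Continuous (comb a) :=
  LinearMap.continuous_of_finiteDimensional _

/-! ### Cube faces and sections -/

/-- The face of the cube `[0,1]^n` whose image under `comb a` is the cell of `t`. -/
def cube (t : Label n) : Set (Fin n → ℝ) :=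
  {x | ∀ i, (0 ≤ x i ∧ x i ≤ 1) ∧ (i ∈ t.1 → x i = 1) ∧ (i ∉ t.1 → i ∉ t.2 → x i = 0)}

/-- The union of the faces of the cube with labels in `P`. -/
def cubes (P : Set (Label n)) : Set (Fin n → ℝ) := {x | ∃ t ∈ P, x ∈ cube t}

/-- The coefficient vectors of the zonotope of the vectors with index outside `Q`. -/
def box (Q : Finset (Fin n)) : Set (Fin n → ℝ) :=
  {x | ∀ i, (0 ≤ x i ∧ x i ≤ 1) ∧ (i ∈ Q → x i = 0)}

theorem isCompact_cube (t : Label n) : IsCompact (cube t) := by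
  have h : cube t = (Set.univ.pi fun i => Set.Icc (0 : ℝ) 1) ∩
      {x | ∀ i, (i ∈ t.1 → x i = 1) ∧ (i ∉ t.1 → i ∉ t.2 → x i = 0)} := by
    ext x
    simp only [cube, Set.mem_ofPred_eq, Set.mem_inter_iff, Set.mem_univ_pi, Set.mem_Icc]
    exact forall_and
  rw [h]
  refine (isCompact_univ_pi fun i => isCompact_Icc).inter_right ?_
  simp only [Set.ofPred_forall, Set.ofPred_and]
  refine isClosed_iInter fun i => IsClosed.inter ?_ ?_
  · exact isClosed_iInter fun _ => isClosed_eq (continuous_apply i) continuous_const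
  · exact isClosed_iInter fun _ => isClosed_iInter fun _ =>
      isClosed_eq (continuous_apply i) continuous_const

theorem isClosed_image_cube (a : Fin n → Pt d) (t : Label n) : IsClosed (comb a '' cube t) :=
  ((isCompact_cube t).image (continuous_comb a)).isClosed

/-- A finite family of faces of the cube (of any dimension) which `comb a` maps bijectively onto
the zonotope of the vectors with index outside `Q`. -/
structure IsSection (a : Fin n → Pt d) (Q : Finset (Fin n)) (P : Set (Label n)) : Prop where
  indep : ∀ t ∈ P, ∀ x : Fin n → ℝ, (∀ i ∉ t.2, x i = 0) → comb a x = 0 → x = 0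
  card_le : ∀ t ∈ P, t.2.card ≤ d + 1
  subset : cubes P ⊆ box Q
  inj : ∀ x ∈ cubes P, ∀ y ∈ cubes P, comb a x = comb a y → x = y
  surj : ∀ x ∈ box Q, ∃ y ∈ cubes P, comb a y = comb a x

/-! ### Following a section along a segment -/

/-- A transitive relation that relates the points of each set of a finite closed cover of an
interval relates the endpoints of the interval. -/
theorem rel_of_finite_closed_cover {ι : Type*} [DecidableEq ι] (S : ι → Set ℝ)
    (hS : ∀ i, IsClosed (S i)) (R : ℝ → ℝ → Prop) (v : ℝ)
    (htrans : ∀ r s t, R r s → R s t → R r t) (F : Finset ι) :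
    ∀ u, u ≤ v → (∀ r ∈ Set.Icc u v, ∃ i ∈ F, r ∈ S i) →
      (∀ i ∈ F, ∀ r ∈ S i, ∀ s ∈ S i, u ≤ r → r ≤ s → s ≤ v → R r s) → R u v := by
  induction F using Finset.strongInduction with
  | H F ih =>
    intro u huv hcov hR
    obtain ⟨i, hi, hui⟩ := hcov u ⟨le_rfl, huv⟩
    have hc : IsCompact (S i ∩ Set.Icc u v) := isCompact_Icc.inter_left (hS i)
    -- Jump to the last point m of `S i`. The other sets cover (m, v], hence [m, v] since their
    -- union is closed, and `S i` can be discarded.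
    obtain ⟨m, ⟨hm, hum, hmv⟩, hmax⟩ := hc.exists_isGreatest ⟨u, hui, le_rfl, huv⟩
    have hR1 : R u m := hR i hi u hui m hm le_rfl hum hmv
    rcases hmv.eq_or_lt with rfl | hlt
    · exact hR1
    refine htrans _ _ _ hR1 (ih (F.erase i) (Finset.erase_ssubset hi) m hmv ?_ ?_)
    · have hcl : IsClosed (⋃ j ∈ F.erase i, S j) := isClosed_biUnion_finset fun j _ => hS j
      have hsub : Set.Ioc m v ⊆ ⋃ j ∈ F.erase i, S j := by
        intro r hr
        obtain ⟨j, hj, hrj⟩ := hcov r ⟨hum.trans hr.1.le, hr.2⟩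
        have hji : j ≠ i := by
          rintro rfl
          exact absurd (hmax ⟨hrj, hum.trans hr.1.le, hr.2⟩) (not_le.2 hr.1)
        exact Set.mem_biUnion (Finset.mem_coe.2 (Finset.mem_erase.2 ⟨hji, hj⟩)) hrj
      have := closure_minimal hsub hcl
      rw [closure_Ioc hlt.ne] at this
      intro r hr
      simpa using this hr
    · intro j hj r hr s hs h1 h2 h3
      exact hR j (Finset.mem_of_mem_erase hj) r hr s hs (hum.trans h1) h2 h3

theorem convex_box (Q : Finset (Fin n)) : Convex ℝ (box Q) := by
  intro x hx y hy α β hα hβ h i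
  obtain ⟨⟨h1, h2⟩, h3⟩ := hx i
  obtain ⟨⟨h4, h5⟩, h6⟩ := hy i
  simp only [Pi.add_apply, Pi.smul_apply, smul_eq_mul]
  refine ⟨⟨by positivity, by nlinarith⟩, fun hi => by simp [h3 hi, h6 hi]⟩

/-- Along a segment in the direction `v_q`, the coefficient of `v_q` grows at a rate between `0`
and `1`, and where the rate is `1` the other coefficients are constant. -/
theorem IsSection.exists_path {a : Fin n → Pt d} {Q : Finset (Fin n)} {P : Set (Label n)}
    (h : IsSection a Q P) {q : Fin n} {x y : Fin n → ℝ} (hx : x ∈ box Q) (hy : y ∈ box Q) {s : ℝ}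
    (hs : 0 ≤ s) (hxy : comb a y = comb a x + s • lift a q) :
    ∃ γ : ℝ → Fin n → ℝ,
      (∀ r, 0 ≤ r → r ≤ s → γ r ∈ cubes P ∧ comb a (γ r) = comb a x + r • lift a q) ∧
      ∀ r r', 0 ≤ r → r ≤ r' → r' ≤ s → 0 ≤ γ r' q - γ r q ∧ γ r' q - γ r q ≤ r' - r ∧
        (γ r' q - γ r q = r' - r → γ r' = γ r + Pi.single q (r' - r)) := by
  classical
  have hex : ∀ r, ∃ z, 0 ≤ r → r ≤ s → z ∈ cubes P ∧ comb a z = comb a x + r • lift a q := by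
    intro r
    by_cases hr : 0 ≤ r ∧ r ≤ s
    · obtain ⟨hr0, hrs⟩ := hr
      have hmem : (1 - r / s) • x + (r / s) • y ∈ box Q := by
        refine convex_box Q hx hy ?_ (by positivity) (by ring)
        have := div_le_one_of_le₀ hrs hs
        linarith
      obtain ⟨z, hz, hz'⟩ := h.surj _ hmem
      refine ⟨z, fun _ _ => ⟨hz, ?_⟩⟩
      rw [hz', map_add, map_smul, map_smul, hxy, smul_add, ← add_assoc, ← add_smul, smul_smul,
        sub_add_cancel, one_smul]
      congr 2
      rcases hs.eq_or_lt with rfl | hs'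
      · have : r = 0 := le_antisymm hrs hr0
        simp [this]
      · field_simp
    · exact ⟨0, fun h1 h2 => absurd ⟨h1, h2⟩ hr⟩
  choose γ hγ using hex
  refine ⟨γ, hγ, fun u v hu huv hv => ?_⟩
  have hcont : Continuous fun r : ℝ => comb a x + r • lift a q := by fun_prop
  refine rel_of_finite_closed_cover
    (fun t : Label n => (fun r : ℝ => comb a x + r • lift a q) ⁻¹' (comb a '' cube t))
    (fun t => (isClosed_image_cube a t).preimage hcont)
    (fun r r' => 0 ≤ γ r' q - γ r q ∧ γ r' q - γ r q ≤ r' - r ∧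
        (γ r' q - γ r q = r' - r → γ r' = γ r + Pi.single q (r' - r))) v ?_
    (Set.toFinite P).toFinset u huv ?_ ?_
  · rintro r s t ⟨h1, h2, h3⟩ ⟨h4, h5, h6⟩
    refine ⟨by linarith, by linarith, fun he => ?_⟩
    -- Both increments are bounded by the lengths, so equality for the total forces equality on each
    -- piece.
    rw [h6 (by linarith), h3 (by linarith), add_assoc, ← Pi.single_add]
    congr 2
    ring
  · rintro r ⟨hr1, hr2⟩
    obtain ⟨⟨t, ht, hm⟩, he⟩ := hγ r (hu.trans hr1) (hr2.trans hv)
    exact ⟨t, by simpa using ht, ⟨_, hm, he⟩⟩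
  · rintro t ht r ⟨z, hz, hz'⟩ r' ⟨w, hw, hw'⟩ h1 h2 h3
    have ht : t ∈ P := by simpa using ht
    obtain ⟨h4, h5⟩ := hγ r (hu.trans h1) (h2.trans (h3.trans hv))
    obtain ⟨h6, h7⟩ := hγ r' ((hu.trans h1).trans h2) (h3.trans hv)
    obtain rfl : z = γ r := h.inj _ ⟨t, ht, hz⟩ _ h4 (hz'.trans h5.symm)
    obtain rfl : w = γ r' := h.inj _ ⟨t, ht, hw⟩ _ h6 (hw'.trans h7.symm)
    -- Within one tile the rate is constant: 1 if q is a free direction, by independence, and 0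
    -- otherwise.
    by_cases hq : q ∈ t.2 ∧ q ∉ t.1
    · have key : γ r' - γ r - Pi.single q (r' - r) = 0 := by
        refine h.indep t ht _ (fun i hi => ?_) ?_
        · have hiq : i ≠ q := fun e => hi (e ▸ hq.1)
          by_cases hit : i ∈ t.1
          · simp [(hz i).2.1 hit, (hw i).2.1 hit, hiq]
          · simp [(hz i).2.2 hit hi, (hw i).2.2 hit hi, hiq]
        · rw [map_sub, map_sub, h5, h7, comb_single, sub_smul]
          abel
      have key' : γ r' = γ r + Pi.single q (r' - r) := by
        rw [sub_sub, sub_eq_zero] at key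
        exact key
      have : γ r' q = γ r q + (r' - r) := by
        conv_lhs => rw [key']
        simp
      exact ⟨by linarith, by linarith, fun _ => key'⟩
    · have : γ r' q = γ r q := by
        by_cases hit : q ∈ t.1
        · rw [(hz q).2.1 hit, (hw q).2.1 hit]
        · have hi : q ∉ t.2 := fun h => hq ⟨h, hit⟩
          rw [(hz q).2.2 hit hi, (hw q).2.2 hit hi]
      refine ⟨by linarith, by linarith, fun he => ?_⟩
      have hrr : r' = r := by linarith
      subst hrr
      simp

theorem comb_update (a : Fin n → Pt d) (x : Fin n → ℝ) (q : Fin n) :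
    comb a x = comb a (Function.update x q 0) + x q • lift a q := by
  rw [← comb_single, ← map_add]
  congr 1
  ext i
  by_cases hi : i = q
  · subst hi; simp
  · simp [hi]

/-- The two points differ by a multiple of v_q equal to the difference of their q-coefficients, so
the rate is 1 on the whole segment and the other coefficients never move. If x ≠ y, the midpoint has
a fractional q-coefficient; d + 1 further fractional ones would exceed the number of free directions
of a face. -/
theorem IsSection.eq_off {a : Fin n → Pt d} {Q : Finset (Fin n)} {P : Set (Label n)}
    (h : IsSection a Q P) {q : Fin n} {x y : Fin n → ℝ} (hx : x ∈ cubes P) (hy : y ∈ cubes P)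
    (hxy : comb a (Function.update x q 0) = comb a (Function.update y q 0)) :
    (∀ i, i ≠ q → x i = y i) ∧
      (∀ F : Finset (Fin n), d + 1 ≤ F.card → (∀ i ∈ F, i ≠ q ∧ 0 < x i ∧ x i < 1) → x = y) := by
  wlog hle : x q ≤ y q generalizing x y
  · obtain ⟨h1, h2⟩ := this hy hx hxy.symm (le_of_not_ge hle)
    refine ⟨fun i hi => (h1 i hi).symm, fun F hF hF' => (h2 F hF fun i hi => ?_).symm⟩
    obtain ⟨h3, h4⟩ := hF' i hi
    rw [h1 i h3]
    exact ⟨h3, h4⟩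
  obtain ⟨γ, hγ, hγ'⟩ := h.exists_path (q := q) (h.subset hx) (h.subset hy)
    (sub_nonneg.2 hle) (by rw [comb_update a y q, comb_update a x q, hxy, add_assoc, ← add_smul,
      add_sub_cancel])
  have hs := sub_nonneg.2 hle
  have h0 : γ 0 = x := h.inj _ (hγ 0 le_rfl hs).1 _ hx (by simp [(hγ 0 le_rfl hs).2])
  have h1 : γ (y q - x q) = y := by
    refine h.inj _ (hγ _ hs le_rfl).1 _ hy ?_
    rw [(hγ _ hs le_rfl).2, comb_update a y q, comb_update a x q, hxy, add_assoc, ← add_smul,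
      add_sub_cancel]
  have hy' := (hγ' 0 _ le_rfl hs le_rfl).2.2 (by rw [h0, h1]; ring)
  rw [h0, h1] at hy'
  refine ⟨fun i hi => by rw [hy']; simp [hi], fun F hF hF' => ?_⟩
  by_contra hne
  have hlt : x q < y q := by
    refine lt_of_le_of_ne hle fun e => hne ?_
    rw [hy', e]; simp
  have hm0 : 0 ≤ (y q - x q) / 2 := by linarith
  have hm1 : (y q - x q) / 2 ≤ y q - x q := by linarith
  obtain ⟨b1, b2, b3⟩ := hγ' 0 _ le_rfl hm0 hm1
  obtain ⟨b4, b5, b6⟩ := hγ' _ _ hm0 hm1 le_rfl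
  rw [h0] at b1 b2 b3
  rw [h1] at b4 b5 b6
  have hz := b3 (by linarith)
  obtain ⟨⟨t, ht, hzt⟩, -⟩ := hγ _ hm0 hm1
  rw [hz] at hzt
  have hsub : insert q F ⊆ t.2 := by
    intro i hi
    have hfrac : 0 < (x + Pi.single q ((y q - x q) / 2 - 0) : Fin n → ℝ) i ∧
        (x + Pi.single q ((y q - x q) / 2 - 0) : Fin n → ℝ) i < 1 := by
      rcases Finset.mem_insert.1 hi with rfl | hi
      · have := ((h.subset hx) i).1
        have := ((h.subset hy) i).1
        simp only [Pi.add_apply, Pi.single_eq_same]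
        constructor <;> linarith
      · obtain ⟨h3, h4⟩ := hF' i hi
        simpa [h3] using h4
    by_contra hit
    by_cases hi1 : i ∈ t.1
    · exact hfrac.2.ne ((hzt i).2.1 hi1)
    · exact hfrac.1.ne' ((hzt i).2.2 hi1 hit)
  have hcard := Finset.card_le_card hsub
  rw [Finset.card_insert_of_notMem fun hq => (hF' q hq).1 rfl] at hcard
  have := h.card_le t ht
  omega

/-! ### Deletion of vectors -/

/-- The label obtained by deleting the elements of `Q`. -/
def del (Q : Finset (Fin n)) (t : Label n) : Label n := (t.1 \ Q, t.2 \ Q)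

/-- The coefficient vector obtained by deleting the elements of `Q`. -/
def drop (Q : Finset (Fin n)) (x : Fin n → ℝ) : Fin n → ℝ := fun i => if i ∈ Q then 0 else x i

theorem drop_insert (Q : Finset (Fin n)) (q : Fin n) (x : Fin n → ℝ) :
    drop (insert q Q) x = Function.update (drop Q x) q 0 := by
  ext i
  by_cases hi : i = q
  · subst hi; simp [drop]
  · simp [drop, hi]

theorem drop_singleton (q : Fin n) (x : Fin n → ℝ) :
    drop {q} x = Function.update x q 0 := by
  ext i
  by_cases hi : i = q
  · subst hi; simp [drop]
  · simp [drop, hi]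

theorem drop_mem_cube {Q : Finset (Fin n)} {t : Label n} {x : Fin n → ℝ} (hx : x ∈ cube t) :
    drop Q x ∈ cube (del Q t) := by
  intro i
  obtain ⟨h1, h2, h3⟩ := hx i
  by_cases hi : i ∈ Q
  · simp [drop, del, hi]
  · simpa [drop, del, hi] using ⟨h1, h2, h3⟩

theorem exists_drop_eq {Q : Finset (Fin n)} {t : Label n} {x : Fin n → ℝ}
    (hx : x ∈ cube (del Q t)) : ∃ y ∈ cube t, drop Q y = x := by
  refine ⟨fun i => if i ∈ Q then (if i ∈ t.1 then 1 else 0) else x i, fun i => ?_, ?_⟩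
  · obtain ⟨h1, h2, h3⟩ := hx i
    by_cases hi : i ∈ Q
    · by_cases hit : i ∈ t.1 <;> simp [hi, hit]
    · simp only [del, Finset.mem_sdiff, hi, not_false_eq_true, and_true] at h2 h3
      simpa [hi] using ⟨h1, h2, h3⟩
  · ext i
    obtain ⟨h1, h2, h3⟩ := hx i
    by_cases hi : i ∈ Q
    · simpa [drop, hi] using (h3 (by simp [del, hi]) (by simp [del, hi])).symm
    · simp [drop, hi]

theorem cubes_del (Q : Finset (Fin n)) (P : Set (Label n)) :
    cubes (del Q '' P) = drop Q '' cubes P := by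
  ext x
  constructor
  · rintro ⟨_, ⟨t, ht, rfl⟩, hx⟩
    obtain ⟨y, hy, rfl⟩ := exists_drop_eq hx
    exact ⟨y, ⟨t, ht, hy⟩, rfl⟩
  · rintro ⟨y, ⟨t, ht, hy⟩, rfl⟩
    exact ⟨_, ⟨t, ht, rfl⟩, drop_mem_cube hy⟩

/-- Injectivity is `IsSection.eq_off`; surjectivity is an intermediate value argument on the segment
from x to x + v_q. -/
theorem IsSection.del_singleton {a : Fin n → Pt d} {Q : Finset (Fin n)} {P : Set (Label n)}
    (h : IsSection a Q P) {q : Fin n} (hq : q ∉ Q) :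
    IsSection a (insert q Q) (del {q} '' P) where
  indep := by
    rintro _ ⟨t, ht, rfl⟩ x hx
    refine h.indep t ht x fun i hi => hx i ?_
    simp [del, hi]
  card_le := by
    rintro _ ⟨t, ht, rfl⟩
    exact (Finset.card_le_card Finset.sdiff_subset).trans (h.card_le t ht)
  subset := by
    rw [cubes_del]
    rintro _ ⟨x, hx, rfl⟩ i
    have := h.subset hx i
    by_cases hi : i = q
    · simp [drop, hi]
    · simpa [drop, hi] using this
  inj := by
    rw [cubes_del]
    rintro _ ⟨x, hx, rfl⟩ _ ⟨y, hy, rfl⟩ hxy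
    rw [drop_singleton, drop_singleton] at hxy
    have := (h.eq_off hx hy hxy).1
    ext i
    by_cases hi : i = q
    · simp [drop, hi]
    · simp [drop, hi, this i hi]
  surj := by
    intro x hx
    rw [cubes_del]
    have hxq : x q = 0 := (hx q).2 (Finset.mem_insert_self _ _)
    have hx1 : x ∈ box Q := fun i => ⟨(hx i).1, fun hi => (hx i).2 (Finset.mem_insert_of_mem hi)⟩
    have hy1 : x + Pi.single q 1 ∈ box Q := by
      intro i
      by_cases hi : i = q
      · subst hi; simp [hxq, hq]
      · simpa [hi] using hx1 i
    obtain ⟨γ, hγ, hγ'⟩ := h.exists_path (q := q) hx1 hy1 zero_le_one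
      (by rw [map_add, comb_single])
    -- The defect r - γ r q is at most 0 at r = 0 and at least 0 at r = 1. At a zero, the
    -- q-coefficient accounts for the whole displacement r v_q, so dropping it leads back to `comb a
    -- x`.
    have hcont : ContinuousOn (fun r => r - γ r q) (Set.Icc 0 1) := by
      have hl : LipschitzOnWith 1 (fun r => γ r q) (Set.Icc 0 1) := by
        refine LipschitzOnWith.of_le_add fun r hr r' hr' => ?_
        rw [Real.dist_eq]
        rcases le_total r r' with hle | hle
        · have := (hγ' r r' hr.1 hle hr'.2).1
          have := abs_nonneg (r - r')
          linarith
        · have := (hγ' r' r hr'.1 hle hr.2).2.1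
          have := le_abs_self (r - r')
          linarith
      exact continuousOn_id.sub hl.continuousOn
    have h0 := h.subset (hγ 0 le_rfl zero_le_one).1 q
    have h1 := h.subset (hγ 1 zero_le_one le_rfl).1 q
    obtain ⟨r, hr, hr'⟩ := intermediate_value_Icc zero_le_one hcont
      (show (0 : ℝ) ∈ Set.Icc _ _ from ⟨by linarith [h0.1.1], by linarith [h1.1.2]⟩)
    obtain ⟨h2, h3⟩ := hγ r hr.1 hr.2
    refine ⟨_, ⟨_, h2, rfl⟩, ?_⟩
    rw [comb_update a _ q] at h3
    have : γ r q = r := by simp only at hr'; linarith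
    rw [this] at h3
    rw [drop_singleton]
    exact add_right_cancel h3

/-- The second claim says that deletion does not glue tiles along full-dimensional pieces. Each
single deletion is reversible at a point with d + 1 fractional coordinates outside Q, by
`IsSection.eq_off`. -/
theorem IsSection.del {a : Fin n → Pt d} {P : Set (Label n)} (h : IsSection a ∅ P)
    (Q : Finset (Fin n)) : IsSection a Q (del Q '' P) ∧
      ∀ x ∈ cubes P, ∀ y ∈ cubes P, comb a (drop Q x) = comb a (drop Q y) →
        ∀ F : Finset (Fin n), d + 1 ≤ F.card → (∀ i ∈ F, i ∉ Q ∧ 0 < x i ∧ x i < 1) → x = y := by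
  induction Q using Finset.induction_on with
  | empty =>
    have h1 : ZonotopalTiling.del (∅ : Finset (Fin n)) = id := by ext t <;> simp [ZonotopalTiling.del]
    have h2 : drop (∅ : Finset (Fin n)) = id := by ext t; simp [drop]
    rw [h1, h2, Set.image_id]
    exact ⟨h, fun x hx y hy hxy _ _ _ => h.inj x hx y hy hxy⟩
  | insert q Q hq ih =>
    obtain ⟨ih1, ih2⟩ := ih
    constructor
    · have := ih1.del_singleton hq
      rw [← Set.image_comp] at this
      convert this using 2
      ext t <;> simp [ZonotopalTiling.del] <;> tauto
    · intro x hx y hy hxy F hF hF'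
      rw [drop_insert, drop_insert] at hxy
      have hx' : drop Q x ∈ cubes (ZonotopalTiling.del Q '' P) := by
        rw [cubes_del]; exact ⟨x, hx, rfl⟩
      have hy' : drop Q y ∈ cubes (ZonotopalTiling.del Q '' P) := by
        rw [cubes_del]; exact ⟨y, hy, rfl⟩
      have := (ih1.eq_off hx' hy' hxy).2 F hF fun i hi => by
        obtain ⟨h1, h2⟩ := hF' i hi
        rw [Finset.mem_insert, not_or] at h1
        exact ⟨h1.1, by simpa [drop, h1.2] using h2⟩
      refine ih2 x hx y hy (by rw [this]) F hF fun i hi => ?_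
      obtain ⟨h1, h2⟩ := hF' i hi
      exact ⟨fun h => h1 (Finset.mem_insert_of_mem h), h2⟩

/-! ### Tilings as sections -/

theorem comb_fst (a : Fin n → Pt d) (x : Fin n → ℝ) : (comb a x).1 = ∑ i, x i • a i := by
  rw [comb_apply, Prod.fst_sum]; rfl

theorem comb_snd (a : Fin n → Pt d) (x : Fin n → ℝ) : (comb a x).2 = ∑ i, x i := by
  rw [comb_apply, Prod.snd_sum]; simp [lift]

theorem IsSimplexIndex.indep {a : Fin n → Pt d} {B : Finset (Fin n)} (hB : IsSimplexIndex a B)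
    {x : Fin n → ℝ} (hx : ∀ i ∉ B, x i = 0) (h : comb a x = 0) : x = 0 := by
  have h1 := congrArg Prod.fst h
  have h2 := congrArg Prod.snd h
  rw [comb_fst, ← Finset.sum_subset (Finset.subset_univ B) (fun i _ hi => by simp [hx i hi]),
    ← Finset.sum_coe_sort] at h1
  rw [comb_snd, ← Finset.sum_subset (Finset.subset_univ B) (fun i _ hi => by simp [hx i hi]),
    ← Finset.sum_coe_sort] at h2
  have := affineIndependent_iff.1 hB.2 Finset.univ (fun i => x i) h2 h1
  ext i
  by_cases hi : i ∈ B
  · exact this ⟨i, hi⟩ (Finset.mem_univ _)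
  · exact hx i hi

theorem cell_eq (a : Fin n → Pt d) {t : Label n} (ht : Disjoint t.1 t.2) :
    cell a t = comb a '' cube t := by
  have key : ∀ x ∈ cube t, comb a x = ∑ i ∈ t.1, lift a i + ∑ b ∈ t.2, x b • lift a b := by
    intro x hx
    have h1 : ∑ i ∈ t.1, lift a i = ∑ i ∈ t.1, x i • lift a i :=
      Finset.sum_congr rfl fun i hi => by rw [(hx i).2.1 hi, one_smul]
    rw [h1, ← Finset.sum_union ht, comb_apply]
    refine (Finset.sum_subset (Finset.subset_univ _) fun i _ hi => ?_).symm
    rw [Finset.mem_union, not_or] at hi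
    rw [(hx i).2.2 hi.1 hi.2, zero_smul]
  ext p
  constructor
  · rintro ⟨c, hc, rfl⟩
    have hx : (fun i => if i ∈ t.1 then 1 else if i ∈ t.2 then c i else 0) ∈ cube t := by
      intro i
      by_cases h1 : i ∈ t.1
      · simp [h1]
      · by_cases h2 : i ∈ t.2
        · simpa [h1, h2] using hc i h2
        · simp [h1, h2]
    refine ⟨_, hx, ?_⟩
    rw [key _ hx]
    congr 1
    refine Finset.sum_congr rfl fun b hb => ?_
    simp [hb, Finset.disjoint_right.1 ht hb]
  · rintro ⟨x, hx, rfl⟩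
    exact ⟨x, fun b _ => (hx b).1, key x hx⟩

theorem zonotope_eq (a : Fin n → Pt d) : zonotope a = comb a '' box ∅ := by
  ext p
  simp only [zonotope, box, Set.mem_image, ← comb_apply]
  constructor
  · rintro ⟨c, hc, rfl⟩
    exact ⟨c, by simpa using hc, rfl⟩
  · rintro ⟨c, hc, rfl⟩
    exact ⟨c, fun i => (hc i).1, rfl⟩

theorem cube_subset_of_isFace {f t : Label n} (h : IsFace f t) : cube f ⊆ cube t := by
  obtain ⟨h1, h2, h3, h4⟩ := h
  intro x hx i
  refine ⟨(hx i).1, fun hi => (hx i).2.1 (h3 hi), fun hi hi' => (hx i).2.2 (fun h => ?_)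
    fun h => hi' (h1 h)⟩
  rcases Finset.mem_union.1 (h4 h) with h | h
  exacts [hi h, hi' h]

theorem cube_inj {a : Fin n → Pt d} {t : Label n} (h : IsSimplexIndex a t.2)
    {x y : Fin n → ℝ} (hx : x ∈ cube t) (hy : y ∈ cube t) (hxy : comb a x = comb a y) :
    x = y := by
  refine sub_eq_zero.1 (h.indep (fun i hi => ?_) (by rw [map_sub, hxy, sub_self]))
  by_cases hi' : i ∈ t.1
  · simp [(hx i).2.1 hi', (hy i).2.1 hi']
  · simp [(hx i).2.2 hi' hi, (hy i).2.2 hi' hi]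

/-- Injectivity is where labelled faces matter: a point of two tiles has coefficients in the common
face, and these agree with its coefficients in either tile by independence. -/
theorem IsFineTiling.isSection {a : Fin n → Pt d} {P : Set (Label n)} (hP : IsFineTiling a P) :
    IsSection a ∅ P where
  indep t ht x hx h := (hP.nondegenerate t ht).indep hx h
  card_le t ht := (hP.nondegenerate t ht).1.le
  subset := by
    rintro x ⟨t, -, hx⟩ i
    exact ⟨(hx i).1, by simp⟩
  inj := by
    rintro x ⟨t, ht, hx⟩ y ⟨t', ht', hy⟩ hxy
    have hm : comb a x ∈ cell a t ∩ cell a t' := by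
      rw [cell_eq a (hP.disjoint t ht), cell_eq a (hP.disjoint t' ht')]
      exact ⟨⟨x, hx, rfl⟩, ⟨y, hy, hxy.symm⟩⟩
    rcases hP.inter t ht t' ht' with h | ⟨f, hf, hf', h⟩
    · rw [h] at hm; exact hm.elim
    · rw [h, cell_eq a hf.2.1] at hm
      obtain ⟨z, hz, hzx⟩ := hm
      rw [← cube_inj (hP.nondegenerate t ht) (cube_subset_of_isFace hf hz) hx hzx]
      exact cube_inj (hP.nondegenerate t' ht') (cube_subset_of_isFace hf' hz) hy (hzx.trans hxy)
  surj := by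
    intro x hx
    have hm : comb a x ∈ zonotope a := by rw [zonotope_eq]; exact ⟨x, hx, rfl⟩
    rw [← hP.cover] at hm
    obtain ⟨t, ht, hm⟩ := Set.mem_iUnion₂.1 hm
    rw [cell_eq a (hP.disjoint t ht)] at hm
    obtain ⟨y, hy, hyx⟩ := hm
    exact ⟨y, ⟨t, ht, hy⟩, hyx⟩

/-! ### Simplices as slices at height 1 -/

theorem mem_convexHull_image_iff (a : Fin n → Pt d) (S : Set (Fin n)) (ξ : Pt d) :
    ξ ∈ convexHull ℝ (a '' S) ↔
      ∃ x : Fin n → ℝ, (∀ i, 0 ≤ x i) ∧ (∀ i ∉ S, x i = 0) ∧ comb a x = (ξ, 1) := by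
  classical
  constructor
  · intro h
    let D : Set (Fin n → ℝ) := {x | (∀ i, 0 ≤ x i) ∧ (∀ i ∉ S, x i = 0) ∧ (comb a x).2 = 1}
    have hD : Convex ℝ D := by
      rintro x ⟨h1, h2, h3⟩ y ⟨h4, h5, h6⟩ α β hα hβ hαβ
      refine ⟨fun i => ?_, fun i hi => ?_, ?_⟩
      · have := h1 i
        have := h4 i
        simp only [Pi.add_apply, Pi.smul_apply, smul_eq_mul]
        positivity
      · simp [h2 i hi, h5 i hi]
      · simp [h3, h6, hαβ]
    have hsub : convexHull ℝ (a '' S) ⊆ (LinearMap.fst ℝ _ _ ∘ₗ comb a) '' D := by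
      refine convexHull_min ?_ (hD.linear_image _)
      rintro _ ⟨i, hi, rfl⟩
      refine ⟨Pi.single i 1, ⟨fun j => ?_, fun j hj => ?_, ?_⟩, ?_⟩
      · by_cases hji : j = i
        · subst hji; simp
        · simp [hji]
      · have : j ≠ i := by rintro rfl; exact hj hi
        simp [this]
      · simp [comb_single, lift]
      · simp [comb_single, lift]
    obtain ⟨x, ⟨h1, h2, h3⟩, h4⟩ := hsub h
    exact ⟨x, h1, h2, Prod.ext h4 h3⟩
  · rintro ⟨x, h1, h2, h3⟩
    have h4 := congrArg Prod.fst h3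
    have h5 := congrArg Prod.snd h3
    rw [comb_fst] at h4
    rw [comb_snd] at h5
    simp only at h4 h5
    rw [← Finset.sum_subset (Finset.subset_univ (Finset.univ.filter (· ∈ S)))
      (fun i _ hi => by simp [h2 i (by simpa using hi)])] at h4 h5
    rw [← h4]
    refine (convex_convexHull ℝ _).sum_mem (fun i _ => h1 i) h5 fun i hi => ?_
    exact subset_convexHull ℝ _ ⟨i, by simpa using hi, rfl⟩

theorem mem_simplex_iff (a : Fin n → Pt d) (B : Finset (Fin n)) (ξ : Pt d) :
    ξ ∈ simplex a B ↔
      ∃ x : Fin n → ℝ, (∀ i, 0 ≤ x i) ∧ (∀ i ∉ B, x i = 0) ∧ comb a x = (ξ, 1) := by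
  rw [simplex, mem_convexHull_image_iff]; rfl

theorem le_one_of_comb {a : Fin n → Pt d} {x : Fin n → ℝ} {ξ : Pt d} (h0 : ∀ i, 0 ≤ x i)
    (h : comb a x = (ξ, 1)) (i : Fin n) : x i ≤ 1 := by
  have h5 := congrArg Prod.snd h
  rw [comb_snd] at h5
  rw [← show ∑ i, x i = 1 from h5]
  exact Finset.single_le_sum (fun j _ => h0 j) (Finset.mem_univ i)

theorem isClosed_simplex (a : Fin n → Pt d) (B : Finset (Fin n)) : IsClosed (simplex a B) :=
  ((B.finite_toSet.image a).isCompact_convexHull (𝕜 := ℝ)).isClosed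

theorem IsSimplexIndex.affineSpan_eq_top {a : Fin n → Pt d} {B : Finset (Fin n)}
    (hB : IsSimplexIndex a B) : affineSpan ℝ (Set.range fun b : B => a b) = ⊤ := by
  rw [hB.2.affineSpan_eq_top_iff_card_eq_finrank_add_one]
  simp [hB.1]

theorem simplex_eq_range (a : Fin n → Pt d) (B : Finset (Fin n)) :
    simplex a B = convexHull ℝ (Set.range fun b : B => a b) := by
  rw [simplex, Set.image_eq_range]; rfl

theorem IsSimplexIndex.interior_nonempty {a : Fin n → Pt d} {B : Finset (Fin n)}
    (hB : IsSimplexIndex a B) : (interior (simplex a B)).Nonempty := by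
  rw [simplex_eq_range, interior_convexHull_nonempty_iff_affineSpan_eq_top]
  exact hB.affineSpan_eq_top

theorem IsSimplexIndex.closure_interior {a : Fin n → Pt d} {B : Finset (Fin n)}
    (hB : IsSimplexIndex a B) : closure (interior (simplex a B)) = simplex a B := by
  have hc : Convex ℝ (simplex a B) := convex_convexHull ℝ _
  rw [hc.closure_interior_eq_closure_of_nonempty_interior hB.interior_nonempty,
    (isClosed_simplex a B).closure_eq]

theorem IsSimplexIndex.pos_of_mem_interior {a : Fin n → Pt d} {B : Finset (Fin n)}
    (hB : IsSimplexIndex a B) {ξ : Pt d} (hξ : ξ ∈ interior (simplex a B)) :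
    ∃ x : Fin n → ℝ, (∀ i ∈ B, 0 < x i) ∧ (∀ i ∉ B, x i = 0) ∧ comb a x = (ξ, 1) := by
  let b : AffineBasis B ℝ (Pt d) := ⟨fun b : B => a b, hB.2, hB.affineSpan_eq_top⟩
  have hb : ∀ i, b i = a i := fun i => rfl
  rw [simplex_eq_range] at hξ
  change ξ ∈ interior (convexHull ℝ (Set.range b)) at hξ
  rw [b.interior_convexHull] at hξ
  let x : Fin n → ℝ := fun i => if h : i ∈ B then b.coord ⟨i, h⟩ ξ else 0
  have hx : ∀ i : B, x i = b.coord i ξ := fun i => by simp [x]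
  have hx0 : ∀ i ∉ B, x i = 0 := fun i hi => by simp [x, hi]
  refine ⟨x, fun i hi => ?_, hx0, ?_⟩
  · rw [hx ⟨i, hi⟩]; exact hξ ⟨i, hi⟩
  · refine Prod.ext ?_ ?_
    · rw [comb_fst, ← Finset.sum_subset (Finset.subset_univ B) (fun i _ hi => by simp [hx0 i hi]),
        ← Finset.sum_coe_sort]
      simp only [hx]
      exact b.linear_combination_coord_eq_self ξ
    · rw [comb_snd, ← Finset.sum_subset (Finset.subset_univ B) (fun i _ hi => by simp [hx0 i hi]),
        ← Finset.sum_coe_sort]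
      simp only [hx]
      exact b.sum_coord_apply_eq_one ξ

/-- The slice is an affine subspace; were it all of ℝ^d, W would contain every (ξ,1) and have
dimension d + 1. -/
theorem volume_slice_eq_zero (W : Submodule ℝ (Pt d × ℝ)) (hW : Module.finrank ℝ W ≤ d) :
    MeasureTheory.volume {ξ : Pt d | (ξ, (1 : ℝ)) ∈ W} = 0 := by
  let f : Pt d →ᵃ[ℝ] Pt d × ℝ := (AffineMap.id ℝ (Pt d)).prod (AffineMap.const ℝ (Pt d) 1)
  have hset : {ξ : Pt d | (ξ, (1 : ℝ)) ∈ W} = (W.toAffineSubspace.comap f : Set (Pt d)) := rfl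
  rw [hset]
  refine MeasureTheory.Measure.addHaar_affineSubspace _ _ fun htop => ?_
  have hall : ∀ ξ : Pt d, (ξ, (1 : ℝ)) ∈ W := fun ξ => by
    have : ξ ∈ W.toAffineSubspace.comap f := by rw [htop]; trivial
    exact this
  have hWtop : W = ⊤ := by
    refine eq_top_iff.2 fun p _ => ?_
    have h1 := W.sub_mem (hall p.1) (hall 0)
    have h2 := W.add_mem h1 (W.smul_mem p.2 (hall 0))
    simpa using h2
  rw [hWtop, finrank_top] at hW
  simp at hW

/-! ### Link regions from deletion -/

/-- The vector with coordinates `1` on `I` and half those of `w` elsewhere. -/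
def raise (I : Finset (Fin n)) (w : Fin n → ℝ) : Fin n → ℝ := fun i => if i ∈ I then 1 else w i / 2

theorem raise_mem_cube {t : Label n} {a : Fin n → Pt d} {w : Fin n → ℝ} {ξ : Pt d}
    (h0 : ∀ i, 0 ≤ w i) (h1 : ∀ i ∉ t.2, w i = 0) (h : comb a w = (ξ, 1)) :
    raise t.1 w ∈ cube t := by
  intro i
  have := h0 i
  have := le_one_of_comb h0 h i
  by_cases hi : i ∈ t.1
  · simp [raise, hi]
  · simp only [raise, hi, if_false]
    exact ⟨⟨by linarith, by linarith⟩, fun h => h.elim, fun _ hi' => by simp [h1 i hi']⟩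

theorem drop_raise {I Q : Finset (Fin n)} (hI : I ⊆ Q) {w : Fin n → ℝ} (hw : ∀ i ∈ Q, w i = 0) :
    drop Q (raise I w) = (1 / 2 : ℝ) • w := by
  ext i
  by_cases hi : i ∈ Q
  · simp [drop, hi, hw i hi]
  · have : i ∉ I := fun h => hi (hI h)
    simp [drop, raise, hi, this]
    ring

namespace IsFineTiling

variable {a : Fin n → Pt d} {P : Set (Label n)}

/-- The points over the simplices of the tiles that remain when `Q` is deleted determine their
barycentric coordinates. -/
theorem coord_unique (hP : IsFineTiling a P) {Q : Finset (Fin n)} {t t' : Label n} (ht : t ∈ P)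
    (ht' : t' ∈ P) (hQ : t.1 ⊆ Q) (hQ' : t'.1 ⊆ Q) (hd : Disjoint t.2 Q) (hd' : Disjoint t'.2 Q)
    {ξ : Pt d} {w w' : Fin n → ℝ} (h0 : ∀ i, 0 ≤ w i) (h1 : ∀ i ∉ t.2, w i = 0)
    (h : comb a w = (ξ, 1)) (h0' : ∀ i, 0 ≤ w' i) (h1' : ∀ i ∉ t'.2, w' i = 0)
    (h' : comb a w' = (ξ, 1)) : w = w' ∧ ((∀ i ∈ t.2, 0 < w i) → t.1 = t'.1) := by
  have hx : raise t.1 w ∈ cubes P := ⟨t, ht, raise_mem_cube h0 h1 h⟩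
  have hy : raise t'.1 w' ∈ cubes P := ⟨t', ht', raise_mem_cube h0' h1' h'⟩
  have e1 := drop_raise hQ fun i hi => h1 i (Finset.disjoint_right.1 hd hi)
  have e2 := drop_raise hQ' fun i hi => h1' i (Finset.disjoint_right.1 hd' hi)
  have hxy : comb a (drop Q (raise t.1 w)) = comb a (drop Q (raise t'.1 w')) := by
    rw [e1, e2, map_smul, map_smul, h, h']
  obtain ⟨k1, k2⟩ := hP.isSection.del Q
  constructor
  · have := k1.inj _ (by rw [cubes_del]; exact ⟨_, hx, rfl⟩) _
      (by rw [cubes_del]; exact ⟨_, hy, rfl⟩) hxy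
    rw [e1, e2] at this
    exact smul_right_injective _ (by norm_num : (1 / 2 : ℝ) ≠ 0) this
  · intro hpos
    have := k2 _ hx _ hy hxy t.2 (hP.nondegenerate t ht).1.ge fun i hi => by
      have h3 : i ∉ t.1 := Finset.disjoint_right.1 (hP.disjoint t ht) hi
      have h4 := hpos i hi
      have h5 := le_one_of_comb h0 h i
      refine ⟨Finset.disjoint_left.1 hd hi, ?_⟩
      simp only [raise, h3, if_false]
      constructor <;> linarith
    -- Off the bottom vertex the halved coordinates are at most 1/2, so the bottom vertex is exactly
    -- where the coordinate is 1.
    ext i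
    have hi := congrFun this i
    have h5 := le_one_of_comb h0 h i
    have h6 := le_one_of_comb h0' h' i
    by_cases h3 : i ∈ t.1 <;> by_cases h4 : i ∈ t'.1 <;>
      simp only [raise, h3, h4, if_true, if_false] at hi ⊢ <;> linarith

theorem exists_mem_simplex (hP : IsFineTiling a P) {Q : Finset (Fin n)} {ξ : Pt d}
    (hξ : ξ ∈ hullOutside a Q) : ∃ t ∈ P, t.1 ⊆ Q ∧ ξ ∈ simplex a (t.2 \ Q) := by
  obtain ⟨x, h0, h1, h⟩ := (mem_convexHull_image_iff a _ ξ).1 hξ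
  have hbox : (1 / 2 : ℝ) • x ∈ box Q := by
    intro i
    have := h0 i
    have := le_one_of_comb h0 h i
    simp only [Pi.smul_apply, smul_eq_mul]
    exact ⟨⟨by linarith, by linarith⟩, fun hi => by simp [h1 i (by simpa using hi)]⟩
  obtain ⟨y, ⟨_, ⟨t, ht, rfl⟩, hy⟩, hyx⟩ := (hP.isSection.del Q).1.surj _ hbox
  rw [map_smul, h] at hyx
  have hy2 : comb a ((2 : ℝ) • y) = (ξ, 1) := by
    rw [map_smul, hyx, smul_smul]; norm_num
  have hy0 : ∀ i, 0 ≤ ((2 : ℝ) • y) i := fun i => by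
    have := (hy i).1.1
    simpa using this
  -- A coefficient 1 outside Q would double to 2, but barycentric coordinates are at most 1.
  have htQ : t.1 ⊆ Q := by
    intro i hi
    by_contra hiQ
    have h2 := le_one_of_comb hy0 hy2 i
    have h3 := (hy i).2.1 (by simp [del, hi, hiQ])
    simp [h3] at h2
  refine ⟨t, ht, htQ, (mem_simplex_iff a _ ξ).2 ⟨_, hy0, fun i hi => ?_, hy2⟩⟩
  have : y i = 0 := (hy i).2.2 (by
    simp only [del, Finset.mem_sdiff, not_and, not_not]; exact fun h => htQ h) hi
  simp [this]

theorem mem_linkRegion_iff (hP : IsFineTiling a P) {Q : Finset (Fin n)} {ξ : Pt d} :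
    ξ ∈ linkRegion a P Q ↔ ∃ B, (Q, B) ∈ P ∧ ξ ∈ simplex a B := by
  simp only [linkRegion, region, Set.mem_iUnion₂]
  constructor
  · rintro ⟨⟨I, B⟩, ⟨⟨ht, hc⟩, -, hs⟩, hξ⟩
    obtain rfl := Finset.eq_of_subset_of_card_le hs hc.ge
    exact ⟨B, ht, hξ⟩
  · rintro ⟨B, hB, hξ⟩
    exact ⟨(Q, B), ⟨⟨hB, rfl⟩, (hP.disjoint _ hB).symm, subset_rfl⟩, hξ⟩

theorem isTriangulation (hP : IsFineTiling a P) (Q : Finset (Fin n)) :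
    IsTriangulation a {B | (Q, B) ∈ P} (linkRegion a P Q) where
  nondegenerate B hB := hP.nondegenerate _ hB
  cover := by
    ext ξ
    rw [hP.mem_linkRegion_iff]
    simp
  inter := by
    intro B hB B' hB'
    refine subset_antisymm ?_ (Set.subset_inter
      (convexHull_mono (Set.image_mono (by simp))) (convexHull_mono (Set.image_mono (by simp))))
    rintro ξ ⟨hξ, hξ'⟩
    obtain ⟨w, h0, h1, h⟩ := (mem_simplex_iff a _ ξ).1 hξ
    obtain ⟨w', h0', h1', h'⟩ := (mem_simplex_iff a _ ξ).1 hξ'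
    have := (hP.coord_unique hB hB' subset_rfl subset_rfl (hP.disjoint _ hB).symm
      (hP.disjoint _ hB').symm h0 h1 h h0' h1' h').1
    subst this
    refine (mem_simplex_iff a _ ξ).2 ⟨w, h0, fun i hi => ?_, h⟩
    by_cases hiB : i ∈ B
    · exact h1' i fun h => hi (Finset.mem_inter.2 ⟨hiB, h⟩)
    · exact h1 i hiB

theorem mem_lower_iff {Q : Finset (Fin n)} {ξ : Pt d} :
    ξ ∈ ⋃ r ∈ Finset.range Q.card, region a P r Q ↔
      ∃ t ∈ P, t.1 ⊂ Q ∧ Disjoint t.2 Q ∧ ξ ∈ simplex a t.2 := by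
  simp only [region, Set.mem_iUnion₂]
  constructor
  · rintro ⟨r, hr, t, ⟨⟨ht, hc⟩, hd, hs⟩, hξ⟩
    refine ⟨t, ht, hs.ssubset_of_ne ?_, hd, hξ⟩
    rintro he
    rw [← he, ← hc] at hr
    simp at hr
  · rintro ⟨t, ht, hs, hd, hξ⟩
    exact ⟨_, Finset.mem_range.2 (Finset.card_lt_card hs), t, ⟨⟨ht, rfl⟩, hd, hs.subset⟩, hξ⟩

theorem isClosed_linkRegion (hP : IsFineTiling a P) (Q : Finset (Fin n)) :
    IsClosed (linkRegion a P Q) := by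
  rw [← (hP.isTriangulation Q).cover]
  exact (Set.toFinite _).isClosed_biUnion fun B _ => isClosed_simplex a B

theorem volume_simplex_eq_zero (a : Fin n → Pt d) {C : Finset (Fin n)} (hC : C.card ≤ d) :
    MeasureTheory.volume (simplex a C) = 0 := by
  classical
  refine MeasureTheory.measure_mono_null (fun ξ hξ => ?_)
    (volume_slice_eq_zero (Submodule.span ℝ ((C.image (lift a) : Finset _) : Set (Pt d × ℝ)))
      ((finrank_span_finset_le_card _).trans (Finset.card_image_le.trans hC)))
  obtain ⟨x, -, h1, h⟩ := (mem_simplex_iff a _ ξ).1 hξ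
  change (ξ, (1 : ℝ)) ∈ Submodule.span ℝ _
  rw [← h, comb_apply]
  refine Submodule.sum_mem _ fun i _ => ?_
  by_cases hi : i ∈ C
  · exact Submodule.smul_mem _ _ (Submodule.subset_span (by simpa using ⟨i, hi, rfl⟩))
  · simp [h1 i hi]

/-- The link region is what the tiles of lower order leave uncovered. -/
theorem computedRegion_eq (hP : IsFineTiling a P) (Q : Finset (Fin n)) :
    computedRegion a P Q = linkRegion a P Q := by
  refine subset_antisymm (closure_minimal ?_ (hP.isClosed_linkRegion Q)) ?_
  · set U := interior (hullOutside a Q \ ⋃ r ∈ Finset.range Q.card, region a P r Q)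
    -- What remains of the open set outside the link region lies in finitely many lower-dimensional
    -- simplices; being open and null, it is empty.
    have hopen : IsOpen (U \ linkRegion a P Q) :=
      isOpen_interior.sdiff (hP.isClosed_linkRegion Q)
    have hsub : U \ linkRegion a P Q ⊆ ⋃ C ∈ {C : Finset (Fin n) | C.card ≤ d}, simplex a C := by
      rintro ξ ⟨hξ, hξ'⟩
      obtain ⟨h1, h2⟩ := interior_subset hξ
      rw [mem_lower_iff] at h2
      rw [hP.mem_linkRegion_iff] at hξ'
      obtain ⟨t, ht, hs, hξt⟩ := hP.exists_mem_simplex h1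
      refine Set.mem_biUnion (x := t.2 \ Q) ?_ hξt
      by_contra hc
      have hB := (hP.nondegenerate t ht).1
      have he : t.2 \ Q = t.2 := Finset.eq_of_subset_of_card_le Finset.sdiff_subset (by
        have : ¬ (t.2 \ Q).card ≤ d := hc
        omega)
      rw [he] at hξt
      rcases hs.eq_or_ssubset with rfl | hs
      · exact hξ' ⟨t.2, ht, hξt⟩
      · exact h2 ⟨t, ht, hs, Finset.sdiff_eq_self_iff_disjoint.1 he, hξt⟩
    have hnull : MeasureTheory.volume (U \ linkRegion a P Q) = 0 :=
      MeasureTheory.measure_mono_null hsub ((MeasureTheory.measure_biUnion_null_iff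
        (Set.toFinite _).countable).2 fun C hC => volume_simplex_eq_zero a hC)
    rw [hopen.measure_eq_zero_iff MeasureTheory.volume] at hnull
    exact Set.sdiff_eq_empty.1 hnull
  · intro ξ hξ
    obtain ⟨B, hB, hξ⟩ := hP.mem_linkRegion_iff.1 hξ
    have hd : Disjoint B Q := (hP.disjoint _ hB).symm
    rw [← (hP.nondegenerate _ hB).closure_interior] at hξ
    refine closure_mono (interior_maximal ?_ isOpen_interior) hξ
    intro η hη
    refine ⟨convexHull_mono (Set.image_mono fun i hi => Finset.disjoint_left.1 hd hi)
      (interior_subset hη), fun hlow => ?_⟩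
    obtain ⟨t, ht, hs, hdt, hηt⟩ := mem_lower_iff.1 hlow
    -- Strictly positive coordinates in Δ_B force any overlapping tile to have bottom vertex Q,
    -- against `t.1 ⊂ Q`.
    obtain ⟨w, h0, h1, h⟩ := (hP.nondegenerate _ hB).pos_of_mem_interior hη
    obtain ⟨w', h0', h1', h'⟩ := (mem_simplex_iff a _ η).1 hηt
    have h00 : ∀ i, 0 ≤ w i := fun i => by
      by_cases hi : i ∈ B
      · exact (h0 i hi).le
      · exact (h1 i hi).ge
    have := (hP.coord_unique hB ht subset_rfl hs.subset hd hdt h00 h1 h h0' h1' h').2 h0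
    exact hs.ne this.symm

/-! ### Reaching every bottom vertex from the preceding order -/

/-- Every nonempty bottom vertex of a tile is reached from a tile of the preceding order. -/
theorem exists_lower_tile (hP : IsFineTiling a P) {Q B : Finset (Fin n)} (hQB : (Q, B) ∈ P)
    (hQ : Q.Nonempty) : ∃ b ∈ Q, ∃ B', (Q.erase b, B') ∈ P ∧ b ∈ B' := by
  classical
  have hS := hP.isSection
  have hB := hP.nondegenerate _ hQB
  let vQ : Pt d × ℝ := ∑ i ∈ Q, lift a i
  let W : Finset (Fin n) → Submodule ℝ (Pt d × ℝ) := fun C =>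
    Submodule.span ℝ ((insert vQ (C.image (lift a)) : Finset _) : Set (Pt d × ℝ))
  have hWQ : ∀ C, vQ ∈ W C := fun C => Submodule.subset_span (by simp)
  have hWC : ∀ C, ∀ i ∈ C, lift a i ∈ W C := fun C i hi =>
    Submodule.subset_span (by
      rw [Finset.mem_coe]
      exact Finset.mem_insert_of_mem (Finset.mem_image_of_mem _ hi))
  -- Genericity: fewer than d of the v_i together with the sum over Q span at most d dimensions, and
  -- finitely many such slices do not fill the interior of Δ_B.
  obtain ⟨ξ, hξ, hgen⟩ : ∃ ξ ∈ interior (simplex a B), ∀ C : Finset (Fin n), C.card < d →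
      (ξ, (1 : ℝ)) ∉ W C := by
    by_contra! hcon
    have hnull : MeasureTheory.volume (interior (simplex a B)) = 0 := by
      refine MeasureTheory.measure_mono_null
        (t := ⋃ C ∈ {C : Finset (Fin n) | C.card < d}, {ξ | (ξ, (1 : ℝ)) ∈ W C}) ?_ ?_
      · intro ξ hξ
        obtain ⟨C, hC, h⟩ := hcon ξ hξ
        exact Set.mem_biUnion hC h
      · refine (MeasureTheory.measure_biUnion_null_iff (Set.toFinite _).countable).2
          fun C hC => volume_slice_eq_zero _ ((finrank_span_finset_le_card _).trans ?_)
        have h1 : C.card < d := hC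
        have h2 := Finset.card_insert_le vQ (C.image (lift a))
        have h3 : (C.image (lift a)).card ≤ C.card := Finset.card_image_le
        omega
    rw [isOpen_interior.measure_eq_zero_iff MeasureTheory.volume] at hnull
    exact hB.interior_nonempty.ne_empty hnull
  obtain ⟨w, hw0, hw1, hw⟩ := hB.pos_of_mem_interior hξ
  have hw00 : ∀ i, 0 ≤ w i := fun i => by
    by_cases hi : i ∈ B
    · exact (hw0 i hi).le
    · exact (hw1 i hi).ge
  have hwQ : ∀ i ∈ Q, w i = 0 := fun i hi => hw1 i (Finset.disjoint_left.1 (hP.disjoint _ hQB) hi)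
  set x := raise Q w with hxdef
  have hx : x ∈ cube (Q, B) := raise_mem_cube (t := (Q, B)) hw00 hw1 hw
  have split : ∀ z : Fin n → ℝ, (∀ i ∈ Q, z i = 1) →
      comb a z = vQ + ∑ i ∈ Finset.univ \ Q, z i • lift a i := by
    intro z hz
    rw [comb_apply, ← Finset.sum_sdiff (Finset.subset_univ Q), add_comm]
    congr 1
    exact Finset.sum_congr rfl fun i hi => by rw [hz i hi, one_smul]
  have hcx : comb a x = vQ + (1 / 2 : ℝ) • (ξ, (1 : ℝ)) := by
    rw [split x fun i hi => (hx i).2.1 hi, ← hw, comb_apply, Finset.smul_sum,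
      ← Finset.sum_subset (Finset.subset_univ (Finset.univ \ Q))
        (fun i _ hi => by simp [hwQ i (by simpa using hi)])]
    congr 1
    refine Finset.sum_congr rfl fun i hi => ?_
    have : i ∉ Q := by simpa using hi
    rw [smul_smul]
    simp only [hxdef, raise, this, if_false]
    congr 1
    ring
  have hheight : ∑ i, x i = Q.card + 1 / 2 := by
    rw [← comb_snd a, hcx]
    simp [vQ, Prod.snd_sum, lift]
  -- the tiles that meet the ray through `comb a x`
  have hcont : Continuous fun r : ℝ => r • comb a x := by fun_prop
  let S : Set (Label n) → Set ℝ := fun R =>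
    (fun r : ℝ => r • comb a x) ⁻¹' ⋃ t ∈ R, comb a '' cube t
  have hclosed : ∀ R, IsClosed (S R) := fun R =>
    ((Set.toFinite R).isClosed_biUnion fun t _ => isClosed_image_cube a t).preimage hcont
  have hcov : ∀ r ∈ Set.Icc (0 : ℝ) 1, r ∈ S {t ∈ P | t.1 = Q} ∨ r ∈ S {t ∈ P | t.1 ≠ Q} := by
    rintro r ⟨hr0, hr1⟩
    have hbox : r • x ∈ box ∅ := by
      intro i
      have h1 := (hx i).1
      simp only [Pi.smul_apply, smul_eq_mul]
      exact ⟨⟨mul_nonneg hr0 h1.1, mul_le_one₀ hr1 h1.1 h1.2⟩, by simp⟩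
    obtain ⟨y, ⟨t, ht, hy⟩, hyx⟩ := hS.surj _ hbox
    rw [map_smul] at hyx
    by_cases htQ : t.1 = Q
    · exact Or.inl (Set.mem_biUnion (x := t) ⟨ht, htQ⟩ ⟨y, hy, hyx⟩)
    · exact Or.inr (Set.mem_biUnion (x := t) ⟨ht, htQ⟩ ⟨y, hy, hyx⟩)
  have h1S : (1 : ℝ) ∈ S {t ∈ P | t.1 = Q} :=
    Set.mem_biUnion (x := (Q, B)) ⟨hQB, rfl⟩ ⟨x, hx, by simp⟩
  -- The parameter m is where the ray first meets a tile with bottom vertex Q. By closedness it also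
  -- lies in a tile with another bottom vertex, and the section gives both tiles the same
  -- coefficients z.
  obtain ⟨m, ⟨hmS, hm0, hm1⟩, hmin⟩ :=
    ((isCompact_Icc (a := (0 : ℝ)) (b := 1)).inter_left (hclosed _)).exists_isLeast
      ⟨1, h1S, zero_le_one, le_rfl⟩
  obtain ⟨t, ⟨ht, htQ⟩, z, hz, hzx⟩ := Set.mem_iUnion₂.1 hmS
  have hzQ : ∀ i ∈ Q, z i = 1 := fun i hi => (hz i).2.1 (htQ ▸ hi)
  have hzsum : ∑ i, z i = m * (Q.card + 1 / 2) := by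
    have := congrArg Prod.snd hzx
    rw [comb_snd] at this
    rw [this, ← hheight, ← comb_snd a]
    rfl
  -- The coordinates on Q already use up |Q| of a height of at most |Q| + 1/2.
  have hz1 : ∀ i ∉ Q, z i ≤ 1 / 2 := by
    intro i hi
    have h1 : ∑ j ∈ insert i Q, z j ≤ ∑ j, z j :=
      Finset.sum_le_sum_of_subset_of_nonneg (Finset.subset_univ _) fun j _ _ => (hz j).1.1
    rw [Finset.sum_insert hi, Finset.sum_congr rfl hzQ, hzsum] at h1
    have h2 : m * (Q.card + 1 / 2) ≤ 1 * (Q.card + 1 / 2 : ℝ) := by gcongr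
    simp at h1
    linarith
  have hmpos : 0 < m := by
    refine lt_of_le_of_ne hm0 fun h => ?_
    obtain ⟨q, hq⟩ := hQ
    have h1 : z q ≤ ∑ i, z i := Finset.single_le_sum (fun j _ => (hz j).1.1) (Finset.mem_univ q)
    rw [hzsum, ← h, hzQ q hq] at h1
    norm_num at h1
  have hmS' : m ∈ S {t ∈ P | t.1 ≠ Q} := by
    have hsub : Set.Ico 0 m ⊆ S {t ∈ P | t.1 ≠ Q} := fun r hr =>
      (hcov r ⟨hr.1, hr.2.le.trans hm1⟩).resolve_left fun h =>
        absurd (hmin ⟨h, hr.1, hr.2.le.trans hm1⟩) (not_le.2 hr.2)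
    have := closure_minimal hsub (hclosed _)
    rw [closure_Ico hmpos.ne] at this
    exact this ⟨hm0, le_rfl⟩
  obtain ⟨t', ⟨ht', htQ'⟩, z', hz', hzx'⟩ := Set.mem_iUnion₂.1 hmS'
  obtain rfl : z = z' := hS.inj _ ⟨t, ht, hz⟩ _ ⟨t', ht', hz'⟩ (hzx.trans hzx'.symm)
  let C : Finset (Fin n) := (Finset.univ \ Q).filter (z · ≠ 0)
  have hCd : d ≤ C.card := by
    by_contra! hlt
    refine hgen C hlt ?_
    have hmem : comb a z ∈ W C := by
      rw [split z hzQ]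
      refine Submodule.add_mem _ (hWQ C) (Submodule.sum_mem _ fun i hi => ?_)
      by_cases hzi : z i = 0
      · simp [hzi]
      · exact Submodule.smul_mem _ _ (hWC C i (Finset.mem_filter.2 ⟨hi, hzi⟩))
    have he : (ξ, (1 : ℝ)) = (2 : ℝ) • (m⁻¹ • comb a z - vQ) := by
      have hzx2 : comb a z = m • comb a x := hzx
      rw [hzx2, smul_smul, inv_mul_cancel₀ hmpos.ne', one_smul, hcx, add_sub_cancel_left, smul_smul]
      norm_num
    rw [he]
    exact Submodule.smul_mem _ _ (Submodule.sub_mem _ (Submodule.smul_mem _ _ hmem) (hWQ C))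
  have hsub1 : t'.1 ⊆ Q := by
    intro i hi
    by_contra hiQ
    have h1 := hz1 i hiQ
    rw [(hz' i).2.1 hi] at h1
    norm_num at h1
  have hsub2 : ∀ i, i ∉ t'.1 → z i ≠ 0 → i ∈ t'.2 := fun i h1 h2 => by
    by_contra h3
    exact h2 ((hz' i).2.2 h1 h3)
  have hsub3 : (Q \ t'.1) ∪ C ⊆ t'.2 := by
    intro i hi
    rcases Finset.mem_union.1 hi with hi | hi
    · obtain ⟨h1, h2⟩ := Finset.mem_sdiff.1 hi
      exact hsub2 i h2 (by simp [hzQ i h1])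
    · obtain ⟨h1, h2⟩ := Finset.mem_filter.1 hi
      exact hsub2 i (fun h => by simp [hsub1 h] at h1) h2
  have hdisj : Disjoint (Q \ t'.1) C := by
    rw [Finset.disjoint_left]
    intro i h1 h2
    simp only [Finset.mem_sdiff, C, Finset.mem_filter] at h1 h2
    exact h2.1.2 h1.1
  -- The d + 1 free directions of t' contain at least d indices outside Q and all of Q \ t'.1, which
  -- is nonempty and so has exactly one element.
  have hcard := Finset.card_le_card hsub3
  rw [Finset.card_union_of_disjoint hdisj, (hP.nondegenerate t' ht').1] at hcard
  have hne : (Q \ t'.1).Nonempty := by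
    rw [Finset.sdiff_nonempty]
    exact fun h => htQ' (subset_antisymm hsub1 h)
  have hpos := hne.card_pos
  obtain ⟨b, hb⟩ := Finset.card_eq_one.1 (show (Q \ t'.1).card = 1 by omega)
  have hbm : b ∈ Q \ t'.1 := by rw [hb]; simp
  have he : Q.erase b = t'.1 := by
    rw [← Finset.sdiff_singleton_eq_erase, ← hb, Finset.sdiff_sdiff_eq_self hsub1]
  exact ⟨b, (Finset.mem_sdiff.1 hbm).1, t'.2, by rw [he]; exact ht',
    hsub3 (Finset.mem_union_left _ hbm)⟩

end IsFineTiling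

/-! ### The construction, stage by stage -/

theorem computedRegion_congr (a : Fin n → Pt d) {S S' : Set (Label n)} {Q : Finset (Fin n)}
    (h : ∀ r < Q.card, ofOrder S r = ofOrder S' r) :
    computedRegion a S Q = computedRegion a S' Q := by
  have : ∀ r ∈ Finset.range Q.card, region a S r Q = region a S' r Q := fun r hr => by
    rw [region, region, h r (Finset.mem_range.1 hr)]
  rw [computedRegion, computedRegion, Set.iUnion₂_congr this]

namespace IsFineTiling

variable {a : Fin n → Pt d} {P : Set (Label n)}

/-- The set of simplices over the tiles of `P` with bottom vertex `I`. -/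
abbrev links (P : Set (Label n)) (I : Finset (Fin n)) : Set (Finset (Fin n)) := {B | (I, B) ∈ P}

theorem linkRegion_nonempty_iff (hP : IsFineTiling a P) {Q : Finset (Fin n)} :
    (linkRegion a P Q).Nonempty ↔ ∃ B, (Q, B) ∈ P := by
  constructor
  · rintro ⟨ξ, hξ⟩
    obtain ⟨B, hB, -⟩ := hP.mem_linkRegion_iff.1 hξ
    exact ⟨B, hB⟩
  · rintro ⟨B, hB⟩
    obtain ⟨ξ, hξ⟩ := (hP.nondegenerate _ hB).interior_nonempty
    exact ⟨ξ, hP.mem_linkRegion_iff.2 ⟨B, hB, interior_subset hξ⟩⟩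

/-- For Q = ∅ nothing is subtracted, and the hull of an affinely spanning set has interior. -/
theorem exists_order_zero (hP : IsFineTiling a P) (ha : affineSpan ℝ (Set.range a) = ⊤) :
    ∃ B, (∅, B) ∈ P := by
  rw [← hP.linkRegion_nonempty_iff, ← hP.computedRegion_eq]
  have : (interior (convexHull ℝ (Set.range a))).Nonempty :=
    interior_convexHull_nonempty_iff_affineSpan_eq_top.2 ha
  simpa [computedRegion, hullOutside, Set.image_univ] using this

theorem computedRegion_eq_of_card_le (hP : IsFineTiling a P) {k : ℕ} {Q : Finset (Fin n)}
    (hQ : Q.card ≤ k) : computedRegion a {t ∈ P | t.1.card < k} Q = linkRegion a P Q := by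
  rw [← hP.computedRegion_eq]
  refine computedRegion_congr a fun r hr => ?_
  ext t
  simp only [ofOrder, Set.mem_ofPred_eq]
  constructor
  · rintro ⟨⟨h1, -⟩, h2⟩
    exact ⟨h1, h2⟩
  · rintro ⟨h1, h2⟩
    exact ⟨⟨h1, by omega⟩, h2⟩

theorem newTiles_eq (P : Set (Label n)) (k : ℕ) :
    newTiles (links P) {Q | Q.card = k ∧ ∃ B, (Q, B) ∈ P} = ofOrder P k := by
  ext ⟨I, B⟩
  simp only [newTiles, ofOrder, Set.mem_ofPred_eq]
  constructor
  · rintro ⟨⟨h1, -⟩, h2⟩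
    exact ⟨h2, h1⟩
  · rintro ⟨h1, h2⟩
    exact ⟨⟨h2, B, h1⟩, h1⟩

/-- Induction on k. The subtraction formula makes the nonemptiness test equivalent to being a bottom
vertex of P, and `exists_lower_tile` ensures that every bottom vertex of size k + 1 is tested. -/
theorem state_eq (hP : IsFineTiling a P) (ha : affineSpan ℝ (Set.range a) = ⊤) (k : ℕ) :
    state a (links P) k = ({Q | Q.card = k ∧ ∃ B, (Q, B) ∈ P}, {t ∈ P | t.1.card < k}) := by
  induction k with
  | zero =>
    refine Prod.ext ?_ ?_
    · ext Q
      simp only [state, Set.mem_singleton_iff, Set.mem_ofPred_eq, Finset.card_eq_zero]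
      constructor
      · rintro rfl
        exact ⟨rfl, hP.exists_order_zero ha⟩
      · exact fun h => h.1
    · simp [state]
  | succ k ih =>
    have hfound : {t ∈ P | t.1.card < k} ∪ ofOrder P k = {t ∈ P | t.1.card < k + 1} := by
      ext t
      simp only [ofOrder, Set.mem_union, Set.mem_ofPred_eq, Nat.lt_succ_iff_lt_or_eq]
      tauto
    rw [state]
    simp only [ih, newTiles_eq, hfound]
    refine Prod.ext ?_ rfl
    ext Q
    simp only [Set.mem_ofPred_eq]
    constructor
    · rintro ⟨t, ⟨ht, hk⟩, b, hb, rfl, hne⟩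
      have hc : (insert b t.1).card = k + 1 := by
        rw [Finset.card_insert_of_notMem (Finset.disjoint_right.1 (hP.disjoint t ht) hb), hk]
      rw [hP.computedRegion_eq_of_card_le hc.le, hP.linkRegion_nonempty_iff] at hne
      exact ⟨hc, hne⟩
    · rintro ⟨hc, B, hB⟩
      obtain ⟨b, hbQ, B', hB', hb⟩ :=
        hP.exists_lower_tile hB (Finset.card_pos.1 (by omega))
      refine ⟨_, ⟨hB', ?_⟩, b, hb, (Finset.insert_erase hbQ).symm, ?_⟩
      · rw [Finset.card_erase_of_mem hbQ]; omega
      · rw [hP.computedRegion_eq_of_card_le hc.le, hP.linkRegion_nonempty_iff]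
        exact ⟨B, hB⟩

theorem order_le (hP : IsFineTiling a P) {t : Label n} (ht : t ∈ P) : t.1.card + d + 1 ≤ n := by
  have h1 := Finset.card_le_univ (t.1 ∪ t.2)
  rw [Finset.card_union_of_disjoint (hP.disjoint t ht), (hP.nondegenerate t ht).1,
    Fintype.card_fin] at h1
  omega

end IsFineTiling

end ZonotopalTiling

end

open ZonotopalTiling in
theorem theorem4 (d n : ℕ) (a : Fin n → Pt d) (ha : affineSpan ℝ (Set.range a) = ⊤)
    (P : Set (Label n)) (hP : IsFineTiling a P) :
    ∃ T : Finset (Fin n) → Set (Finset (Fin n)),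
      -- a triangulation is chosen for the link region of every index set that occurs in `P`
      (∀ I : Finset (Fin n), (∃ B, (I, B) ∈ P) → IsTriangulation a (T I) (linkRegion a P I)) ∧
      -- the construction finds `P^(k)` at stage `k`
      (∀ k : ℕ, k + d + 1 ≤ n →
        (∀ I ∈ indexSets a T k,
          computedRegion a (tilesBefore a T k) I = linkRegion a P I ∧
          IsTriangulation a (T I) (computedRegion a (tilesBefore a T k) I)) ∧
        ofOrder P k = tilesAt a T k ∧
        indexSets a T (k + 1) = {Q | ∃ I B, (I, B) ∈ ofOrder P k ∧ ∃ b ∈ B, b ∉ I ∧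
          Q = insert b I ∧ (linkRegion a P Q).Nonempty}) ∧
      -- it stops after stage `n - d - 1` and has then found all of `P`
      indexSets a T (n - d) = ∅ ∧
      P = ⋃ k ∈ {k : ℕ | k + d + 1 ≤ n}, tilesAt a T k ∧
      {k : ℕ | k + d + 1 ≤ n}.PairwiseDisjoint (tilesAt a T) ∧
      -- it also yields the associated spline spaces of all orders
      (∀ β : Finset (Fin n) → Finset (Fin n), IsSelection a β → ∀ k : ℕ, k + d + 1 ≤ n →
        splineSpace a β k (ofOrder P k) = splineSpace a β k (tilesAt a T k)) := by
  have hstate := hP.state_eq ha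
  have hidx : ∀ k, indexSets a (IsFineTiling.links P) k =
      {Q | Q.card = k ∧ ∃ B, (Q, B) ∈ P} := fun k => by rw [indexSets, hstate]
  have hbefore : ∀ k, tilesBefore a (IsFineTiling.links P) k = {t ∈ P | t.1.card < k} :=
    fun k => by rw [tilesBefore, hstate]
  have hat : ∀ k, tilesAt a (IsFineTiling.links P) k = ofOrder P k := fun k => by
    rw [tilesAt, hidx, IsFineTiling.newTiles_eq]
  -- The triangulations are read off from P itself: over I, take the B of its tiles with bottom
  -- vertex I.
  refine ⟨IsFineTiling.links P, fun I _ => hP.isTriangulation I, fun k _ => ⟨?_, (hat k).symm, ?_⟩,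
    ?_, ?_, ?_, fun β _ k _ => by rw [hat]⟩
  · intro I hI
    rw [hidx] at hI
    rw [hbefore, hP.computedRegion_eq_of_card_le hI.1.le]
    exact ⟨rfl, hP.isTriangulation I⟩
  · rw [hidx]
    ext Q
    simp only [Set.mem_ofPred_eq, hP.linkRegion_nonempty_iff]
    constructor
    · rintro ⟨hc, B, hB⟩
      obtain ⟨b, hbQ, B', hB', hb⟩ := hP.exists_lower_tile hB (Finset.card_pos.1 (by omega))
      refine ⟨_, B', ⟨hB', ?_⟩, b, hb, Finset.notMem_erase b Q, (Finset.insert_erase hbQ).symm,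
        B, hB⟩
      rw [Finset.card_erase_of_mem hbQ]
      omega
    · rintro ⟨I, B, ⟨-, hk⟩, b, -, hbI, rfl, hne⟩
      exact ⟨by rw [Finset.card_insert_of_notMem hbI, hk], hne⟩
  · rw [hidx]
    refine Set.eq_empty_of_forall_notMem ?_
    rintro Q ⟨hc, B, hB⟩
    have := hP.order_le hB
    simp only at this
    omega
  · ext t
    simp only [hat, Set.mem_iUnion₂]
    constructor
    · exact fun ht => ⟨_, hP.order_le ht, ht, rfl⟩
    · rintro ⟨k, -, ht, -⟩
      exact ht
  · intro j _ k _ hjk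
    rw [Function.onFun, hat, hat, Set.disjoint_left]
    rintro t ⟨-, h1⟩ ⟨-, h2⟩
    exact hjk (h1.symm.trans h2)
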